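/- Let $\Sigma=\{0,1\}$. A \emph{group oracle} is a family $B=\{B_n\}_{n\in\mathbb N}$ of bijections $B_n:\Sigma^{2n+2}\to\Sigma^{2n+2}$ such that for every $n$ there are a group $G_n$ and a one-to-one map $f_n:G_n\to\Sigma^n$ with the following property. Write the strings of $\Sigma^{2n+2}$ as $(c,b,x,y)$ with $c,b\in\Sigma$ and $x,y\in\Sigma^n$. If $x=f_n(g)$ and $y=f_n(h)$ with $g,h\in G_n$, then $B_n(0,b,x,y)=(0,b,x,f_n(hg))$ and $B_n(1,b,x,y)=(1,b,x,f_n(hg^{-1}))$; if $x$ or $y$ is not in $f_n(G_n)$, then $B_n(c,b,x,y)=(c,\neg b,x,y)$. $\mathrm{GNM}(B)\subseteq\Sigma^*$ (Group Non-Membership) is the language of binary encodings of all lists $f_n(g_1),\dots,f_n(g_k),f_n(h)$ with $n,k\in\mathbb N$ and $g_1,\dots,g_k,h\in G_n$ such that $h\notin\langle g_1,\dots,g_k\rangle$. The encoding of a list $w_1,\dots,w_k,w\in\Sigma^n$ is $1^k0\,1^n0\,w_1\cdots w_k w$. A language $A\subseteq\Sigma^*$ is in $\mathrm{MA}^B$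 if there are a predicate $R:(\Sigma^*)^3\to\{0,1\}$, computable in polynomial time by a deterministic Turing machine with access to $B$ (one step replaces a query string $w\in\Sigma^{2n+2}$, for any $n$, by $B_n(w)$), and polynomials $q$ and $r$ with natural-number coefficients, $q$ not the zero polynomial, such that for every $x\in\Sigma^*$: - if $x\in A$, then there is $y\in\Sigma^{q(|x|)}$ with $\left|\{z\in\Sigma^{r(|x|)} : R(x,y,z)=1\}\right|=2^{r(|x|)}$; - if $x\notin A$, then for all $y\in\Sigma^{q(|x|)}$, $\left|\{z\in\Sigma^{r(|x|)} : R(x,y,z)=1\}\right|<2^{-2q(|x|)}\,2^{r(|x|)}$. Theorem. There exists a group oracle $B$ such that $\mathrm{GNM}(B)\notin\mathrm{MA}^B$. -/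

import Mathlib

open Polynomial

namespace BlackBox

/-- The set `Σⁿ` of binary strings of length `n`. -/
abbrev Str (n : ℕ) : Type := List.Vector Bool n

/-! ### Group oracles -/

/-- The string of length `2n + 2` that consists of a control bit `c`, an error bit `b` and two
strings `x`, `y` of length `n`. Every string of length `2n + 2` is of this form, uniquely. -/
def quad {n : ℕ} (c b : Bool) (x y : Str n) : Str (2 * n + 2) :=
  ⟨c :: b :: (x.toList ++ y.toList), by
    simp only [List.length_cons, List.length_append, List.Vector.toList_length]; omega⟩

/-- The function `β` on `Σ^{2n+2}` is the multiplication gate of the group `G` whose elements are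
encoded by the one-to-one map `f : G → Σⁿ`. If `x = f g` and `y = f h`, the gate replaces `y` by
the encoding of `h * g` (control bit `0`) or of `h * g⁻¹` (control bit `1`); if `x` or `y` does not
encode a group element, it negates the error bit. -/
def Realizes {n : ℕ} {G : Type} [Group G] (β : Str (2 * n + 2) → Str (2 * n + 2))
    (f : G → Str n) : Prop :=
  Function.Injective f ∧
  (∀ (c b : Bool) (g h : G),
    β (quad c b (f g) (f h)) = quad c b (f g) (f (if c then h * g⁻¹ else h * g))) ∧
  (∀ (c b : Bool) (x y : Str n), (x ∉ Set.range f ∨ y ∉ Set.range f) →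
    β (quad c b x y) = quad c (!b) x y)

/-- A group oracle: a family of bijections `Bₙ : Σ^{2n+2} → Σ^{2n+2}`, each of which is the
multiplication gate of some group encoded by strings of length `n`. -/
structure GroupOracle where
  gate : (n : ℕ) → Equiv.Perm (Str (2 * n + 2))
  exists_group : ∀ n : ℕ, ∃ (G : Type) (_ : Group G) (f : G → Str n), Realizes (gate n) f

/-- The answer of the oracle to a query string `w`: it is `Bₙ(w)` if `w` has length `2n + 2`;
strings of any other length are returned unchanged. -/
def GroupOracle.answer (B : GroupOracle) (w : List Bool) : List Bool :=
  if hw : w.length = 2 * ((w.length - 2) / 2) + 2 then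
    (B.gate ((w.length - 2) / 2) ⟨w, hw⟩).toList
  else w

/-! ### Group non-membership -/

/-- The strings `gs = g₁, …, g_k` and `h` of length `n` all encode elements of the group of `Bₙ`,
and the element `h` lies outside the subgroup generated by `g₁, …, g_k`. -/
def GroupOracle.NonMember (B : GroupOracle) (n : ℕ) (gs : List (Str n)) (h : Str n) : Prop :=
  ∃ (G : Type) (_ : Group G) (f : G → Str n), Realizes (B.gate n) f ∧
    ∃ (us : List G) (v : G), us.map f = gs ∧ f v = h ∧ v ∉ Subgroup.closure {u : G | u ∈ us}

/-- Binary encoding `1ᵏ 0 1ⁿ 0 g₁ … g_k h` of an instance `g₁, …, g_k, h ∈ Σⁿ`. -/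
def encodeInstance {n : ℕ} (gs : List (Str n)) (h : Str n) : List Bool :=
  List.replicate gs.length true ++ false :: (List.replicate n true ++
    false :: ((gs.map List.Vector.toList).flatten ++ h.toList))

/-- The language of (encodings of) all positive instances of Group Non-Membership relative to the
group oracle `B`. -/
def GNM (B : GroupOracle) : Language Bool :=
  {x | ∃ (n : ℕ) (gs : List (Str n)) (h : Str n), B.NonMember n gs h ∧ x = encodeInstance gs h}

/-! ### Deterministic oracle Turing machines -/

/-- Tape symbols: the blank (`none`), the two bits, and `a` further symbols. -/
abbrev Sym (a : ℕ) : Type := Option (Bool ⊕ Fin a)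

/-- The tape symbol of a bit. -/
def Sym.bit {a : ℕ} (b : Bool) : Sym a := some (Sum.inl b)

/-- A two-way infinite tape, blank outside a finite part. `right` lists the symbols from the scanned
cell to the right, `left` the symbols from the cell left of the scanned one to the left. -/
structure Tape (a : ℕ) where
  left : List (Sym a)
  right : List (Sym a)

namespace Tape

variable {a : ℕ}

/-- The tape with the word `w` written on it, the head being on the first symbol of `w`. -/
def init (w : List Bool) : Tape a := ⟨[], w.map Sym.bit⟩

/-- The scanned symbol. -/
def read (T : Tape a) : Sym a := T.right.headD none

/-- Overwrite the scanned symbol. -/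
def write (s : Sym a) (T : Tape a) : Tape a := ⟨T.left, s :: T.right.tail⟩

/-- Move the head by one cell, or leave it where it is (`none`). -/
def move : Option Turing.Dir → Tape a → Tape a
  | none, T => T
  | some Turing.Dir.left, T => ⟨T.left.tail, T.left.headD none :: T.right⟩
  | some Turing.Dir.right, T => ⟨T.right.headD none :: T.left, T.right.tail⟩

/-- The longest prefix of a list of symbols that consists of bits. -/
def bitPrefix : List (Sym a) → List Bool
  | some (Sum.inl b) :: l => b :: bitPrefix l
  | _ => []

/-- Replace the query word, which is the longest block of bits that starts at the scanned cell and
extends to the right, by the answer of the oracle `O`. -/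
def ask (O : List Bool → List Bool) (T : Tape a) : Tape a :=
  ⟨T.left, (O (bitPrefix T.right)).map Sym.bit ++ T.right.drop (bitPrefix T.right).length⟩

end Tape

/-- A deterministic multi-tape oracle Turing machine. Tapes `0`, `1`, `2` initially hold the three
components of the input, tape `3` is the query tape, and there are `numWork` further work tapes. -/
structure OracleTM where
  numStates : ℕ
  numWork : ℕ
  numExtra : ℕ
  start : Fin numStates
  accept : Fin numStates
  reject : Fin numStates
  query : Fin numStates
  resume : Fin numStates
  trans : Fin numStates → (Fin (numWork + 4) → Sym numExtra) →
    Fin numStates × (Fin (numWork + 4) → Sym numExtra × Option Turing.Dir)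

namespace OracleTM

/-- A configuration: a state and the contents and head positions of all tapes. -/
structure Cfg (M : OracleTM) where
  state : Fin M.numStates
  tapes : Fin (M.numWork + 4) → Tape M.numExtra

/-- The initial configuration on input `(x, y, z)`. -/
def initCfg (M : OracleTM) (x y z : List Bool) : M.Cfg where
  state := M.start
  tapes i :=
    if i = 0 then Tape.init x else if i = 1 then Tape.init y
    else if i = 2 then Tape.init z else Tape.init []

/-- One step with oracle `O`. The accepting and the rejecting state halt. In the query state, the
query word is replaced by the oracle's answer, as a single step. -/
def step (M : OracleTM) (O : List Bool → List Bool) (c : M.Cfg) : M.Cfg :=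
  if c.state = M.accept ∨ c.state = M.reject then c
  else if c.state = M.query then
    ⟨M.resume, Function.update c.tapes 3 ((c.tapes 3).ask O)⟩
  else
    let act := M.trans c.state (fun i => (c.tapes i).read)
    ⟨act.1, fun i => Tape.move (act.2 i).2 (Tape.write (act.2 i).1 (c.tapes i))⟩

/-- The output of `M` with oracle `O` on input `(x, y, z)` if `M` halts within `t` steps (`true` for
acceptance, `false` for rejection), and `none` if it does not. -/
def output (M : OracleTM) (O : List Bool → List Bool) (t : ℕ) (x y z : List Bool) : Option Bool :=
  let c := (M.step O)^[t] (M.initCfg x y z)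
  if c.state = M.accept then some true else if c.state = M.reject then some false else none

end OracleTM

/-! ### The class MA relative to a group oracle -/

/-- The predicate `R` is computable in polynomial time (in the length of the input) by a
deterministic Turing machine with access to the group oracle `B`. -/
def PolyTime (B : GroupOracle) (R : List Bool → List Bool → List Bool → Bool) : Prop :=
  ∃ (M : OracleTM) (t : ℕ[X]), ∀ x y z : List Bool,
    M.output B.answer (t.eval (x.length + y.length + z.length)) x y z = some (R x y z)

/-- The number of `z ∈ Σʳ` with `R x y z = 1`. -/
def acceptCount (R : List Bool → List Bool → List Bool → Bool) (x y : List Bool) (r : ℕ) : ℕ :=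
  Fintype.card {z : Str r // R x y z.toList = true}

/-- The class `MA^B`. The length `q` of the certificates is a polynomial other than the zero
polynomial (for which the two conditions below would define `co-NP^B`). -/
def MA (B : GroupOracle) : Set (Language Bool) :=
  {A | ∃ (R : List Bool → List Bool → List Bool → Bool) (q r : ℕ[X]), PolyTime B R ∧ q ≠ 0 ∧
    ∀ x : List Bool,
      (x ∈ A → ∃ y : Str (q.eval x.length),
        acceptCount R x y.toList (r.eval x.length) = 2 ^ r.eval x.length) ∧
      (x ∉ A → ∀ y : Str (q.eval x.length),
        (acceptCount R x y.toList (r.eval x.length) : ℝ) <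
          ((2 : ℝ) ^ (2 * q.eval x.length))⁻¹ * 2 ^ r.eval x.length)}

end BlackBox

/-
If the group of `Bₙ` is a vector space `V` over `F₂`, encoded by a bijection `ψ : Σⁿ ≃ V`, and the
given elements `g₁, …, g_k` span the kernel of a functional `χ`, then `h` is a non-member if and
only if `χ (ψ h) = 1`. Consider a run that asks for few sums, and fix a labeling `ψ₁` with this run
and with `χ (ψ₁ h) = 1`. If `ψ` satisfies the equations `ψ z = ψ x + ψ y` that the run reveals, so
does the shifted labeling `x ↦ ψ x + χ (ψ₁ x) • w`, for every `w : V`. The shift fixes the labels of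
the `gᵢ`, translates the label of `h` by `w`, and is injective on the strings that matter for at
least half of the `w` in any large enough set. Hence, for fixed `y` and `z`, a machine is at most
twice as likely to accept when `h` is a non-member as when `h` is arbitrary in a large set of
labels, such as `ker χ`. Summing over all `y` and `z`, this contradicts completeness for non-members
together with the error bound `2^{-2q}` for members. So every machine can be made to fail by
changing a single gate, and by the Baire category theorem one group oracle makes all of the
countably many machines fail.
-/

namespace BlackBox

open scoped Finset

section Relabelings

variable {K V X : Type*}

lemma exists_perm_apply_eq {ι : Type*} [Finite V] {f g : ι → V} (hf : f.Injective)
    (hg : g.Injective) : ∃ π : Equiv.Perm V, ∀ i, π (f i) = g i := by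
  classical
  let e : {v // v ∈ Set.range f} ≃ {v // v ∈ Set.range g} :=
    (Equiv.ofInjective f hf).symm.trans (Equiv.ofInjective g hg)
  refine ⟨e.extendSubtype, fun i => ?_⟩
  rw [e.extendSubtype_apply_of_mem _ ⟨i, rfl⟩]
  exact congrArg (fun j => g j) (Equiv.ofInjective_symm_apply hf i)

section Shift

variable [DivisionRing K] [AddCommGroup V] [Module K V]

open scoped Classical in
lemma card_filter_not_injOn_add_smul_le {S : Finset X} {σ : X → V} (hσ : Set.InjOn σ S)
    (s : X → K) (W : Finset V) :
    #{w ∈ W | ¬ Set.InjOn (fun x => σ x + s x • w) S} ≤ #S.offDiag := by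
  refine (Finset.card_le_card (t := S.offDiag.image fun p =>
    (s p.2 - s p.1)⁻¹ • (σ p.1 - σ p.2)) fun w hw => ?_).trans Finset.card_image_le
  obtain ⟨x, hx, x', hx', hcollision, hne⟩ : ∃ x ∈ S, ∃ x' ∈ S,
      σ x + s x • w = σ x' + s x' • w ∧ x ≠ x' := by
    simpa [Set.InjOn] using (Finset.mem_filter.1 hw).2
  have hsub : σ x - σ x' = (s x' - s x) • w := by
    rw [sub_smul, sub_eq_sub_iff_add_eq_add, hcollision, add_comm]
  have hs : s x' - s x ≠ 0 := fun h =>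
    hne (hσ hx hx' (sub_eq_zero.1 (by rw [hsub, h, zero_smul])))
  exact Finset.mem_image.2 ⟨(x, x'), Finset.mem_offDiag.2 ⟨hx, hx', hne⟩,
    by rw [hsub, inv_smul_smul₀ hs]⟩

open scoped Classical in
lemma card_le_two_mul_card_filter_injOn_add_smul {S : Finset X} {σ : X → V}
    (hσ : Set.InjOn σ S) (s : X → K) {W : Finset V} (hS : 2 * #S ^ 2 ≤ #W) :
    #W ≤ 2 * #{w ∈ W | Set.InjOn (fun x => σ x + s x • w) S} := by
  have hbad := card_filter_not_injOn_add_smul_le hσ s W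
  have hsplit := Finset.card_filter_add_card_filter_not (s := W)
    fun w => Set.InjOn (fun x => σ x + s x • w) S
  have hoff : #S.offDiag ≤ #S ^ 2 := by
    rw [Finset.offDiag_card, sq]
    exact Nat.sub_le _ _
  omega

/-- A shifted labeling `ψ x + s x • w` of `S` determines `w` by its value at `b`, hence `ψ` on `S`;
it is extended from `S` by a permutation that depends only on this data. -/
lemma card_mul_card_le_of_add_smul_mem [Finite V] {S : Finset X} {W : Finset V} {s : X → K}
    {b : X} {v₀ : V} {P Q : Finset (X ≃ V)} (hS : 2 * #S ^ 2 ≤ #W) (hb : b ∈ S) (hsb : s b = 1)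
    (hP : ∀ ψ ∈ P, ψ b = v₀)
    (hQ : ∀ ψ ∈ P, ∀ w ∈ W, ∀ ψ' : X ≃ V, (∀ x ∈ S, ψ' x = ψ x + s x • w) → ψ' ∈ Q) :
    #W * #P ≤ 2 * #Q := by
  classical
  choose! π hπ using fun f g : S → V => exists_perm_apply_eq (V := V) (f := f) (g := g)
  let shift (ψ : X ≃ V) (w : V) (x : X) : V := ψ x + s x • w
  let good (ψ : X ≃ V) : Finset V := {w ∈ W | Set.InjOn (shift ψ w) S}
  let extend (p : (_ : X ≃ V) × V) : X ≃ V :=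
    p.1.trans (π (S.restrict p.1) (S.restrict (shift p.1 p.2)))
  have hextend : ∀ p ∈ P.sigma good, ∀ x ∈ S, extend p x = shift p.1 p.2 x := fun p hp x hx =>
    hπ _ _ (p.1.injective.comp Subtype.val_injective)
      (Set.injOn_iff_injective.1 (Finset.mem_filter.1 (Finset.mem_sigma.1 hp).2).2) ⟨x, hx⟩
  have hinj : Set.InjOn extend (P.sigma good : Set ((_ : X ≃ V) × V)) := by
    rintro ⟨ψ, w⟩ hp ⟨ψ', w'⟩ hp' heq
    have hshift (x : X) (hx : x ∈ S) : shift ψ w x = shift ψ' w' x := by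
      rw [← hextend _ hp x hx, heq, hextend _ hp' x hx]
    obtain rfl : w = w' := by
      simpa [shift, hsb, hP ψ (Finset.mem_sigma.1 hp).1, hP ψ' (Finset.mem_sigma.1 hp').1]
        using hshift b hb
    have hψ : S.restrict ψ = S.restrict ψ' := funext fun x => add_right_cancel (hshift x x.2)
    have hshift' : S.restrict (shift ψ w) = S.restrict (shift ψ' w) :=
      funext fun x => hshift x x.2
    obtain rfl : ψ = ψ' := Equiv.ext fun x => by
      simpa [extend, hψ, hshift'] using DFunLike.congr_fun heq x
    rfl
  have hcard : #(P.sigma good) ≤ #Q := Finset.card_le_card_of_injOn extend (fun p hp =>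
    hQ p.1 (Finset.mem_sigma.1 hp).1 p.2
      (Finset.mem_filter.1 (Finset.mem_sigma.1 hp).2).1 _ (hextend p hp)) hinj
  calc #W * #P = ∑ _ψ ∈ P, #W := by rw [Finset.sum_const, smul_eq_mul, mul_comm]
    _ ≤ ∑ ψ ∈ P, 2 * #(good ψ) := Finset.sum_le_sum fun ψ _ =>
        card_le_two_mul_card_filter_injOn_add_smul ψ.injective.injOn s hS
    _ = 2 * #(P.sigma good) := by rw [Finset.card_sigma, Finset.mul_sum]
    _ ≤ 2 * #Q := Nat.mul_le_mul_left 2 hcard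

end Shift

section Queries

/-- A labeling `σ` is consistent with a transcript `τ`, a list of triples `(x, y, z)` of a query
`(x, y)` and its answer `z`, if it maps the answers to the sums of the operands. -/
def Consistent [Add V] (τ : Finset (X × X × X)) (σ : X → V) : Prop :=
  ∀ p ∈ τ, σ p.2.2 = σ p.1 + σ p.2.1

/-- The elements that occur in a transcript, as operands of a query or as an answer. -/
def places [DecidableEq X] (τ : Finset (X × X × X)) : Finset X :=
  τ.biUnion fun p => {p.1, p.2.1, p.2.2}

lemma card_places_le [DecidableEq X] (τ : Finset (X × X × X)) : #(places τ) ≤ #τ * 3 :=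
  Finset.card_biUnion_le_card_mul _ _ 3 fun _ _ => Finset.card_le_three

lemma Consistent.of_eq_add_smul [DecidableEq X] [DivisionRing K] [AddCommGroup V] [Module K V]
    {τ : Finset (X × X × X)} {σ σ' : X → V} {s : X → K} {w : V} (hσ : Consistent τ σ)
    (hs : Consistent τ s) (hσ' : ∀ x ∈ places τ, σ' x = σ x + s x • w) : Consistent τ σ' := by
  intro p hp
  have hplaces : ∀ x ∈ ({p.1, p.2.1, p.2.2} : Finset X), σ' x = σ x + s x • w := fun x hx =>
    hσ' x (Finset.mem_biUnion.2 ⟨p, hp, hx⟩)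
  rw [hplaces p.1 (by simp), hplaces p.2.1 (by simp), hplaces p.2.2 (by simp), hσ p hp, hs p hp,
    add_smul, add_add_add_comm]

/-- The property `acc` of a labeling `ψ` can be decided by at most `T` queries to the addition that
`ψ` induces on `X`: the transcript `tr ψ` of the queries determines both itself and `acc ψ`. -/
def DecidedByQueries [Add V] (T : ℕ) (acc : (X ≃ V) → Prop) : Prop :=
  ∃ tr : (X ≃ V) → Finset (X × X × X), ∀ ψ, #(tr ψ) ≤ T ∧ Consistent (tr ψ) ψ ∧
    ∀ ψ' : X ≃ V, Consistent (tr ψ) ψ' → tr ψ' = tr ψ ∧ (acc ψ' ↔ acc ψ)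

/-- The bijections `X ≃ V` that agree with `ψ₀` on `A` and map `b` into `U`. -/
def relabelings [Fintype X] [Fintype V] [DecidableEq X] [DecidableEq V] (ψ₀ : X ≃ V)
    (A : Finset X) (b : X) (U : Finset V) : Finset (X ≃ V) :=
  {ψ | (∀ x ∈ A, ψ x = ψ₀ x) ∧ ψ b ∈ U}

variable [Fintype X] [Fintype V] [DecidableEq X] [DecidableEq V]
  {ψ₀ : X ≃ V} {A : Finset X} {b : X} {U : Finset V}

@[simp] lemma mem_relabelings {ψ : X ≃ V} :
    ψ ∈ relabelings ψ₀ A b U ↔ (∀ x ∈ A, ψ x = ψ₀ x) ∧ ψ b ∈ U := by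
  simp [relabelings]

lemma card_relabelings_le (hb : b ∉ A) :
    #(relabelings ψ₀ A b U) ≤ #U * #(relabelings ψ₀ A b {ψ₀ b}) := by
  rw [← Finset.card_product]
  refine Finset.card_le_card_of_injOn
    (fun ψ => (ψ b, ψ.trans (Equiv.swap (ψ b) (ψ₀ b)))) (fun ψ hψ => ?_) fun ψ _ ψ' _ heq => ?_
  · obtain ⟨hA, hU⟩ := mem_relabelings.1 hψ
    refine Finset.mem_product.2 ⟨hU, mem_relabelings.2 ⟨fun x hx => ?_, by simp⟩⟩
    have hxb : x ≠ b := ne_of_mem_of_not_mem hx hb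
    rw [Equiv.trans_apply, Equiv.swap_apply_of_ne_of_ne (ψ.injective.ne hxb), hA x hx]
    rw [hA x hx]
    exact ψ₀.injective.ne hxb
  · obtain ⟨hval, hcomp⟩ := Prod.ext_iff.1 heq
    dsimp only at hval hcomp
    ext x
    simpa [hval] using DFunLike.congr_fun hcomp x

variable [DivisionRing K] [AddCommGroup V] [Module K V] {T : ℕ}

/-- On the labelings with a given transcript `τ`, the shifts by `χ ∘ ψ₁ • w` keep `τ` consistent,
fix the labels on `A`, and move the label of `b` by `w`. -/
lemma DecidedByQueries.card_mul_card_filter_le {acc : (X ≃ V) → Prop}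
    [DecidablePred acc] (hacc : DecidedByQueries T acc) (χ : V →ₗ[K] K) (hA : ∀ x ∈ A, χ (ψ₀ x) = 0)
    (hb : χ (ψ₀ b) = 1) (hT : 2 * (#A + 1 + 3 * T) ^ 2 ≤ #U) :
    #U * #{ψ ∈ relabelings ψ₀ A b {ψ₀ b} | acc ψ} ≤ 2 * #{ψ ∈ relabelings ψ₀ A b U | acc ψ} := by
  obtain ⟨tr, htr⟩ := hacc
  rw [Finset.card_eq_sum_card_fiberwise (f := tr) (t := Finset.univ)
      (s := {ψ ∈ relabelings ψ₀ A b U | acc ψ}) (by simp),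
    Finset.card_eq_sum_card_fiberwise (f := tr) (t := Finset.univ) (by simp), Finset.mul_sum,
    Finset.mul_sum]
  refine Finset.sum_le_sum fun τ _ => ?_
  obtain hempty | ⟨ψ₁, hψ₁⟩ :=
    ({ψ ∈ {ψ ∈ relabelings ψ₀ A b {ψ₀ b} | acc ψ} | tr ψ = τ}).eq_empty_or_nonempty
  · simp [hempty]
  simp only [Finset.mem_filter, mem_relabelings, Finset.mem_singleton] at hψ₁
  obtain ⟨⟨⟨hψ₁A, hψ₁b⟩, -⟩, rfl⟩ := hψ₁
  let S : Finset X := insert b A ∪ places (tr ψ₁)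
  have hS : #S ≤ #A + 1 + 3 * T := by
    have hplaces := card_places_le (tr ψ₁)
    have htrace := (htr ψ₁).1
    have hinsert := Finset.card_insert_le b A
    have hunion : #S ≤ _ := Finset.card_union_le (insert b A) (places (tr ψ₁))
    omega
  have hbS : b ∈ S := by simp [S]
  let W : Finset V := U.image (· - ψ₀ b)
  have hW : #W = #U := Finset.card_image_of_injective _ sub_left_injective
  rw [← hW]
  refine card_mul_card_le_of_add_smul_mem (s := fun x => χ (ψ₁ x)) (v₀ := ψ₀ b)
    (by rw [hW]; exact hT.trans' (by gcongr)) hbS (by rw [hψ₁b, hb]) (fun ψ hψ => ?_)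
    fun ψ hψ w hw ψ' hψ' => ?_ <;>
  simp only [Finset.mem_filter, mem_relabelings, Finset.mem_singleton] at hψ ⊢ <;>
  obtain ⟨⟨⟨hψA, hψb⟩, hψacc⟩, hψtr⟩ := hψ
  · exact hψb
  obtain ⟨u, hu, rfl⟩ := Finset.mem_image.1 hw
  have hconsistent : Consistent (tr ψ) ψ' :=
    (htr ψ).2.1.of_eq_add_smul (s := fun x => χ (ψ₁ x))
      (fun p hp => by simpa using congrArg χ ((htr ψ₁).2.1 p (hψtr ▸ hp)))
      fun x hx => hψ' x (Finset.mem_union_right _ (hψtr ▸ hx))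
  obtain ⟨htr', hacc'⟩ := (htr ψ).2.2 ψ' hconsistent
  refine ⟨⟨⟨fun x hx => ?_, ?_⟩, hacc'.2 hψacc⟩, htr'.trans hψtr⟩
  · rw [hψ' x (by simp [S, hx]), hψ₁A x hx, hA x hx, zero_smul, add_zero, hψA x hx]
  · rwa [hψ' b hbS, hψb, hψ₁b, hb, one_smul, add_sub_cancel]

lemma two_mul_card_filter_prod_lt {Y Z : Type*} [Fintype Y] [Fintype Z] {p : Y → Z → Prop}
    [∀ y, DecidablePred (p y)] (hY : 2 ≤ Fintype.card Y)
    (hp : ∀ y, Fintype.card Y ^ 2 * #{z | p y z} < Fintype.card Z) :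
    2 * #{ω : Y × Z | p ω.1 ω.2} < Fintype.card Z := by
  have hfib : #{ω : Y × Z | p ω.1 ω.2} = ∑ y, #{z | p y z} := by
    simp only [Finset.card_filter, Fintype.sum_prod_type]
  have : Nonempty Y := Fintype.card_pos_iff.1 (by omega)
  have hsum : ∑ y, Fintype.card Y ^ 2 * #{z | p y z} < ∑ _y : Y, Fintype.card Z :=
    Finset.sum_lt_sum_of_nonempty Finset.univ_nonempty fun y _ => hp y
  rw [← Finset.mul_sum, ← hfib, Finset.sum_const, Finset.card_univ, smul_eq_mul, sq,
    mul_assoc] at hsum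
  exact (Nat.mul_le_mul_right _ hY).trans_lt (Nat.lt_of_mul_lt_mul_left hsum)

/-- Double counting of the triples of a labeling and a pair `(y, z)` that is accepted with it. -/
theorem exists_relabeling_not_verified {Y Z : Type*} [Fintype Y] [Fintype Z] [Nonempty Z]
    {acc : (X ≃ V) → Y → Z → Prop} [∀ ψ y z, Decidable (acc ψ y z)]
    (hacc : ∀ y z, DecidedByQueries T fun ψ => acc ψ y z)
    (χ : V →ₗ[K] K) (hA : ∀ x ∈ A, χ (ψ₀ x) = 0) (hb : χ (ψ₀ b) = 1)
    (hT : 2 * (#A + 1 + 3 * T) ^ 2 ≤ #U) (hY : 2 ≤ Fintype.card Y) :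
    (∃ ψ ∈ relabelings ψ₀ A b {ψ₀ b}, ∀ y, ∃ z, ¬ acc ψ y z) ∨
      ∃ ψ ∈ relabelings ψ₀ A b U, ∃ y,
        Fintype.card Z ≤ Fintype.card Y ^ 2 * #{z | acc ψ y z} := by
  by_contra! hcon
  obtain ⟨hcomplete, hsound⟩ := hcon
  set P := relabelings ψ₀ A b {ψ₀ b}
  set Q := relabelings ψ₀ A b U
  let accepted (ψ : X ≃ V) : Finset (Y × Z) := {ω | acc ψ ω.1 ω.2}
  have hcomplete' : ∀ ψ ∈ P, Fintype.card Z ≤ #(accepted ψ) := fun ψ hψ => by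
    obtain ⟨y, hy⟩ := hcomplete ψ hψ
    rw [← Finset.card_univ]
    exact Finset.card_le_card_of_injOn (Prod.mk y) (by simp [accepted, hy])
      (Prod.mk_right_injective y).injOn
  have hsound' : ∀ ψ ∈ Q, 2 * #(accepted ψ) + 1 ≤ Fintype.card Z := fun ψ hψ =>
    two_mul_card_filter_prod_lt hY (hsound ψ hψ)
  have hcount (R : Finset (X ≃ V)) :
      ∑ ψ ∈ R, #(accepted ψ) = ∑ ω : Y × Z, #{ψ ∈ R | acc ψ ω.1 ω.2} :=
    Finset.sum_card_bipartiteAbove_eq_sum_card_bipartiteBelow (t := Finset.univ)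
      fun ψ (ω : Y × Z) => acc ψ ω.1 ω.2
  have hPpos : 0 < #P := Finset.card_pos.2 ⟨ψ₀, by simp [P]⟩
  have hUpos : 0 < #U := lt_of_lt_of_le (by positivity) hT
  have hbA : b ∉ A := fun h => by simpa [hb] using hA b h
  have hlower : #P * Fintype.card Z ≤ ∑ ψ ∈ P, #(accepted ψ) := by
    simpa using Finset.card_nsmul_le_sum P _ _ hcomplete'
  have hupper : 2 * ∑ ψ ∈ Q, #(accepted ψ) + #Q ≤ #Q * Fintype.card Z := by
    simpa [Finset.sum_add_distrib, Finset.mul_sum] using Finset.sum_le_sum hsound'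
  have hmiddle : #U * ∑ ψ ∈ P, #(accepted ψ) ≤ 2 * ∑ ψ ∈ Q, #(accepted ψ) := by
    rw [hcount, hcount, Finset.mul_sum, Finset.mul_sum]
    exact Finset.sum_le_sum fun ω _ => (hacc ω.1 ω.2).card_mul_card_filter_le χ hA hb hT
  have hcard : #Q * Fintype.card Z ≤ #U * (#P * Fintype.card Z) := by
    rw [← mul_assoc]
    exact Nat.mul_le_mul_right _ (card_relabelings_le hbA)
  have hsum : #U * (#P * Fintype.card Z) + #Q ≤ #Q * Fintype.card Z := by
    linarith [Nat.mul_le_mul_left #U hlower]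
  have hQ : #Q = 0 := by omega
  have hpos : 0 < #U * (#P * Fintype.card Z) :=
    Nat.mul_pos hUpos (Nat.mul_pos hPpos Fintype.card_pos)
  rw [hQ, zero_mul] at hsum
  omega

end Queries

end Relabelings

section Asymptotics

open Asymptotics Filter

lemma isLittleO_eval_natCast_const_pow (p : ℕ[X]) {r : ℝ} (hr : 1 < r) :
    (fun k : ℕ => ((p.eval k : ℕ) : ℝ)) =o[atTop] fun k => r ^ k := by
  induction p using Polynomial.induction_on' with
  | add p q hp hq => simpa only [eval_add, Nat.cast_add] using hp.add hq
  | monomial d c =>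
    simpa only [eval_monomial, Nat.cast_mul, Nat.cast_pow] using
      (isLittleO_pow_const_const_pow_of_one_lt d hr).const_mul_left (c : ℝ)

lemma eventually_eval_le_two_pow (p : ℕ[X]) : ∀ᶠ k : ℕ in atTop, p.eval k ≤ 2 ^ k := by
  filter_upwards [(isLittleO_eval_natCast_const_pow p one_lt_two).bound one_pos] with k hk
  simp only [RCLike.norm_natCast, norm_pow, Real.norm_ofNat, one_mul] at hk
  exact_mod_cast hk

end Asymptotics

lemma eval_pos_of_ne_zero {p : ℕ[X]} (hp : p ≠ 0) {n : ℕ} (hn : 0 < n) : 0 < p.eval n := by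
  obtain ⟨i, hi⟩ := Polynomial.support_nonempty.2 hp
  rw [eval_eq_sum, Polynomial.sum]
  exact Finset.sum_pos' (fun _ _ => Nat.zero_le _) ⟨i, hi, Nat.mul_pos
    (Nat.pos_of_ne_zero (mem_support_iff.1 hi)) (pow_pos hn i)⟩

section Gates

variable {n : ℕ}

lemma quad_inj {c b c' b' : Bool} {x y x' y' : Str n} :
    quad c b x y = quad c' b' x' y' ↔ c = c' ∧ b = b' ∧ x = x' ∧ y = y' := by
  refine ⟨fun h => ?_, by rintro ⟨rfl, rfl, rfl, rfl⟩; rfl⟩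
  have hlist := congrArg List.Vector.toList h
  simp only [quad, List.Vector.toList_mk, List.cons.injEq] at hlist
  obtain ⟨hc, hb, happend⟩ := hlist
  obtain ⟨hx, hy⟩ := List.append_inj happend (by simp)
  exact ⟨hc, hb, List.Vector.toList_injective hx, List.Vector.toList_injective hy⟩

/-- Strings of length `2n + 2` as quadruples of two bits and two strings of length `n`, so that
gates can be defined and queries be read off componentwise. -/
noncomputable def quadEquiv (n : ℕ) : (Bool × Bool × Str n × Str n) ≃ Str (2 * n + 2) :=
  Equiv.ofBijective (fun p => quad p.1 p.2.1 p.2.2.1 p.2.2.2) <| by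
    rw [Fintype.bijective_iff_injective_and_card]
    refine ⟨fun p p' h => ?_, ?_⟩
    · simpa only [Prod.ext_iff] using quad_inj.1 h
    · simp only [Fintype.card_prod, Fintype.card_bool, card_vector]
      ring

@[simp] lemma quadEquiv_symm_quad (c b : Bool) (x y : Str n) :
    (quadEquiv n).symm (quad c b x y) = (c, b, x, y) :=
  (quadEquiv n).symm_apply_apply (c, b, x, y)

lemma exists_quad (w : Str (2 * n + 2)) : ∃ c b x y, quad c b x y = w :=
  ⟨_, _, _, _, (quadEquiv n).apply_symm_apply w⟩

/-- The possible components `Bₙ` of a group oracle. -/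
def GroupGate (n : ℕ) : Type :=
  {β : Equiv.Perm (Str (2 * n + 2)) //
    ∃ (G : Type) (_ : Group G) (f : G → Str n), Realizes β f}

/-- A group oracle is a sequence of gates that can be chosen independently of each other. -/
def GroupOracle.ofGates (β : ∀ n, GroupGate n) : GroupOracle where
  gate n := (β n).1
  exists_group n := (β n).2

/-- The multiplication gate of a group `G` of order `2ⁿ` whose elements label the strings of
length `n` bijectively. -/
noncomputable def groupGatePerm {G : Type*} [Group G] (ψ : Str n ≃ G) :
    Equiv.Perm (Str (2 * n + 2)) :=
  (quadEquiv n).permCongr <| .prodShear (.refl _) fun c => .prodShear (.refl _) fun _ =>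
    .prodShear (.refl _) fun x => ψ.symm.permCongr (.mulRight (if c then (ψ x)⁻¹ else ψ x))

lemma groupGatePerm_quad {G : Type*} [Group G] (ψ : Str n ≃ G) (c b : Bool) (x y : Str n) :
    groupGatePerm ψ (quad c b x y) =
      quad c b x (ψ.symm (if c then ψ y * (ψ x)⁻¹ else ψ y * ψ x)) := by
  cases c <;>
  · simp only [groupGatePerm, Equiv.permCongr_apply, quadEquiv_symm_quad, Equiv.prodShear_apply,
      Equiv.refl_apply, Bool.false_eq_true, ↓reduceIte, Equiv.symm_symm, Equiv.coe_mulRight]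
    rfl

lemma realizes_groupGatePerm {G : Type} [Group G] (ψ : Str n ≃ G) :
    Realizes (groupGatePerm ψ) ψ.symm := by
  refine ⟨ψ.symm.injective, fun c b g h => ?_, fun c b x y hxy => ?_⟩
  · simp only [groupGatePerm_quad, Equiv.apply_symm_apply]
  · simp [ψ.symm.surjective.range_eq] at hxy

section VectorSpace

variable {V : Type} [AddCommGroup V] [Module (ZMod 2) V]

/-- The gate of the additive group of an `𝔽₂`-vector space whose elements label the strings of
length `n` bijectively. -/
noncomputable def vectorGate (ψ : Str n ≃ V) : GroupGate n :=
  ⟨groupGatePerm (ψ.trans Multiplicative.ofAdd), _, _, _, realizes_groupGatePerm _⟩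

lemma vectorGate_quad (ψ : Str n ≃ V) (c b : Bool) (x y : Str n) :
    (vectorGate ψ).1 (quad c b x y) = quad c b x (ψ.symm (ψ x + ψ y)) := by
  refine (groupGatePerm_quad _ c b x y).trans ?_
  cases c
  · simp [← ofAdd_add, add_comm]
  · simp [← ofAdd_add, ← ofAdd_neg, add_comm, ZModModule.neg_eq_self]

end VectorSpace

end Gates

section Answers

variable {n : ℕ}

lemma GroupOracle.answer_toList (B : GroupOracle) (w : Str (2 * n + 2)) :
    B.answer w.toList = (B.gate n w).toList := by
  obtain ⟨l, hl⟩ := w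
  obtain rfl : n = (l.length - 2) / 2 := by omega
  exact dif_pos hl

lemma GroupOracle.answer_congr {B B' : GroupOracle} {w : List Bool}
    (h : ∀ n, w.length = 2 * n + 2 → B.gate n = B'.gate n) : B.answer w = B'.answer w := by
  unfold GroupOracle.answer
  split_ifs with hw
  · rw [h _ hw]
  · rfl

/-- The strings `x` and `y` of a query `(c, b, x, y)` to the gate `Bₙ`; junk if the length of `w` is
not `2n + 2`. -/
noncomputable def operands (n : ℕ) (w : List Bool) : Str n × Str n :=
  if hw : w.length = 2 * n + 2 then ((quadEquiv n).symm ⟨w, hw⟩).2.2 else default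

lemma operands_quad (c b : Bool) (x y : Str n) : operands n (quad c b x y).toList = (x, y) := by
  rw [operands, dif_pos (List.Vector.toList_length _)]
  exact congrArg (fun p => p.2.2) (quadEquiv_symm_quad c b x y)

/-- The product that is computed by the gate `vectorGate ψ` on the query `w`. -/
noncomputable def product {V : Type*} [Add V] (ψ : Str n ≃ V) (w : List Bool) : Str n :=
  ψ.symm (ψ (operands n w).1 + ψ (operands n w).2)

variable {V : Type} [AddCommGroup V] [Module (ZMod 2) V]

lemma answer_update_congr (β : ∀ n, GroupGate n) {ψ ψ' : Str n ≃ V} {w : List Bool}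
    (h : product ψ w = product ψ' w) :
    (GroupOracle.ofGates (Function.update β n (vectorGate ψ))).answer w =
      (GroupOracle.ofGates (Function.update β n (vectorGate ψ'))).answer w := by
  by_cases hw : w.length = 2 * n + 2
  · obtain ⟨c, b, x, y, hquad⟩ := exists_quad ⟨w, hw⟩
    obtain rfl : (quad c b x y).toList = w := congrArg List.Vector.toList hquad
    simp only [product, operands_quad] at h
    simp only [GroupOracle.answer_toList, GroupOracle.ofGates, Function.update_self,
      vectorGate_quad, h]
  · refine GroupOracle.answer_congr fun m hm => ?_
    have hmn : m ≠ n := by rintro rfl; exact hw hm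
    simp only [GroupOracle.ofGates, Function.update_of_ne hmn]

end Answers

section Instances

variable {n : ℕ}

lemma nonMember_iff_of_gate_eq_groupGatePerm {G : Type} [Group G] {B : GroupOracle}
    {ψ : Str n ≃ G} (hB : B.gate n = groupGatePerm ψ) (gs : List (Str n)) (h : Str n) :
    B.NonMember n gs h ↔ ψ h ∉ Subgroup.closure (ψ '' {x | x ∈ gs}) := by
  constructor
  · rintro ⟨H, _, f, ⟨hf, hmul, -⟩, us, v, rfl, rfl, hv⟩ hmem
    let φ : H →* G := MonoidHom.mk' (fun g => ψ (f g)) fun g g' => by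
      have hgate := hmul false false g' g
      rw [hB, groupGatePerm_quad, quad_inj, Equiv.symm_apply_eq] at hgate
      exact hgate.2.2.2.symm
    have himage : ψ '' {x | x ∈ us.map f} = φ '' {u | u ∈ us} := by
      ext
      simp [φ, Equiv.eq_symm_apply]
    rw [himage, ← MonoidHom.map_closure] at hmem
    exact hv ((Subgroup.mem_map_iff_mem (ψ.injective.comp hf)).1 hmem)
  · intro hmem
    refine ⟨G, inferInstance, ψ.symm, hB ▸ realizes_groupGatePerm ψ, gs.map ψ, ψ h, by simp,
      by simp, ?_⟩
    convert hmem using 3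
    ext
    simp [← ψ.eq_symm_apply]

lemma toZModSubmodule_closure {M : Type*} [AddCommGroup M] (n : ℕ) [Module (ZMod n) M]
    (S : Set M) :
    AddSubgroup.toZModSubmodule n (AddSubgroup.closure S) = Submodule.span (ZMod n) S :=
  le_antisymm ((AddSubgroup.toZModSubmodule n).le_symm_apply.1
      ((AddSubgroup.closure_le _).2 Submodule.subset_span))
    (Submodule.span_le.2 AddSubgroup.subset_closure)

lemma nonMember_iff_of_gate_eq_vectorGate {V : Type} [AddCommGroup V] [Module (ZMod 2) V]
    {B : GroupOracle} {ψ : Str n ≃ V} (hB : B.gate n = (vectorGate ψ).1) (gs : List (Str n))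
    (h : Str n) : B.NonMember n gs h ↔ ψ h ∉ Submodule.span (ZMod 2) (ψ '' {x | x ∈ gs}) := by
  rw [nonMember_iff_of_gate_eq_groupGatePerm hB, ← toZModSubmodule_closure]
  have himage : ψ.trans Multiplicative.ofAdd '' {x | x ∈ gs} =
      Multiplicative.toAdd ⁻¹' (ψ '' {x | x ∈ gs}) := by
    rw [Equiv.coe_trans, Set.image_comp]
    exact Equiv.image_eq_preimage_symm _ _
  rw [himage, ← AddSubgroup.toSubgroup_closure]
  rfl

lemma replicate_true_append_false_cons_inj {k k' : ℕ} {l l' : List Bool} :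
    List.replicate k true ++ false :: l = List.replicate k' true ++ false :: l' ↔
      k = k' ∧ l = l' := by
  induction k generalizing k' with
  | zero => cases k' <;> simp [List.replicate_succ]
  | succ k ih => cases k' <;> simp [List.replicate_succ, ih]

lemma flatten_map_toList_append_inj {gs gs' : List (Str n)} {h h' : Str n}
    (hlength : gs.length = gs'.length)
    (hflatten : (gs.map List.Vector.toList).flatten ++ h.toList =
      (gs'.map List.Vector.toList).flatten ++ h'.toList) : gs = gs' ∧ h = h' := by
  obtain ⟨hgs, hh⟩ := List.append_inj' hflatten (by simp)
  refine ⟨List.map_injective_iff.2 List.Vector.toList_injective ?_,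
    List.Vector.toList_injective hh⟩
  refine List.eq_iff_flatten_eq.2 ⟨hgs, ?_⟩
  simp [Function.comp_def, hlength]

lemma encodeInstance_mem_GNM {B : GroupOracle} {gs : List (Str n)} {h : Str n} :
    encodeInstance gs h ∈ GNM B ↔ B.NonMember n gs h := by
  refine ⟨?_, fun hmem => ⟨n, gs, h, hmem, rfl⟩⟩
  rintro ⟨n', gs', h', hmem, hcode⟩
  obtain ⟨hlength, hcode⟩ := replicate_true_append_false_cons_inj.1 hcode
  obtain ⟨rfl, hcode⟩ := replicate_true_append_false_cons_inj.1 hcode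
  obtain ⟨rfl, rfl⟩ := flatten_map_toList_append_inj hlength hcode
  exact hmem

lemma length_encodeInstance (gs : List (Str n)) (h : Str n) :
    (encodeInstance gs h).length = gs.length + 1 + (n + 1 + (gs.length * n + n)) := by
  simp only [encodeInstance, List.length_append, List.length_replicate, List.length_cons,
    List.length_flatten, List.map_map, Function.comp_def, List.Vector.toList_length,
    List.map_const', List.sum_replicate, smul_eq_mul]
  ring

end Instances

namespace OracleTM

variable {M : OracleTM} {O O' : List Bool → List Bool} {x y z : List Bool} {T : ℕ}

/-- The word on the query tape of `M` at time `i`. -/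
def queryWord (M : OracleTM) (O : List Bool → List Bool) (x y z : List Bool) (i : ℕ) : List Bool :=
  Tape.bitPrefix (((M.step O)^[i] (M.initCfg x y z)).tapes 3).right

lemma iterate_step_congr
    (h : ∀ i < T, O (M.queryWord O x y z i) = O' (M.queryWord O x y z i)) :
    ∀ i ≤ T, (M.step O)^[i] (M.initCfg x y z) = (M.step O')^[i] (M.initCfg x y z)
  | 0, _ => rfl
  | i + 1, hi => by
    have hanswer := h i hi
    unfold queryWord at hanswer
    simp only [Function.iterate_succ_apply', ← iterate_step_congr h i (Nat.le_of_succ_le hi), step,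
      Tape.ask, hanswer]

lemma queryWord_congr (h : ∀ i < T, O (M.queryWord O x y z i) = O' (M.queryWord O x y z i))
    {i : ℕ} (hi : i ≤ T) : M.queryWord O x y z i = M.queryWord O' x y z i := by
  rw [queryWord, queryWord, iterate_step_congr h i hi]

lemma output_congr (h : ∀ i < T, O (M.queryWord O x y z i) = O' (M.queryWord O x y z i)) :
    M.output O T x y z = M.output O' T x y z := by
  simp only [output, iterate_step_congr h T le_rfl]

instance : Countable OracleTM := by
  have : Finite Turing.Dir := .of_surjective (fun b : Bool => cond b .left .right) <| by
    rintro (_ | _)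
    exacts [⟨true, rfl⟩, ⟨false, rfl⟩]
  have (s w e : ℕ) : Countable (Fin s → (Fin (w + 4) → Sym e) →
      Fin s × (Fin (w + 4) → Sym e × Option Turing.Dir)) := inferInstance
  let build : (Σ s w e : ℕ, (Fin s × Fin s × Fin s × Fin s × Fin s) × (Fin s →
      (Fin (w + 4) → Sym e) → Fin s × (Fin (w + 4) → Sym e × Option Turing.Dir))) → OracleTM
    | ⟨s, w, e, ⟨start, accept, reject, query, resume⟩, trans⟩ =>
      ⟨s, w, e, start, accept, reject, query, resume, trans⟩
  exact Function.Surjective.countable (f := build) fun M =>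
    ⟨⟨_, _, _, ⟨M.start, M.accept, M.reject, M.query, M.resume⟩, M.trans⟩, rfl⟩

lemma decidedByQueries_output (M : OracleTM) {n : ℕ} (β : ∀ n, GroupGate n) (x y z : List Bool)
    (T : ℕ) {V : Type} [AddCommGroup V] [Module (ZMod 2) V] :
    DecidedByQueries T fun ψ : Str n ≃ V =>
      M.output (GroupOracle.ofGates (Function.update β n (vectorGate ψ))).answer T x y z =
        some true := by
  let O (ψ : Str n ≃ V) := (GroupOracle.ofGates (Function.update β n (vectorGate ψ))).answer
  let entry (ψ : Str n ≃ V) (w : List Bool) := ((operands n w).1, (operands n w).2, product ψ w)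
  refine ⟨fun ψ => (Finset.range T).image fun i => entry ψ (M.queryWord (O ψ) x y z i),
    fun ψ => ⟨Finset.card_image_le.trans (Finset.card_range T).le, ?_, fun ψ' hψ' => ?_⟩⟩
  · intro p hp
    obtain ⟨i, -, rfl⟩ := Finset.mem_image.1 hp
    exact ψ.apply_symm_apply _
  have hproduct : ∀ i < T, product ψ (M.queryWord (O ψ) x y z i) =
      product ψ' (M.queryWord (O ψ) x y z i) := fun i hi =>
    ψ'.eq_symm_apply.2 (hψ' _ (Finset.mem_image_of_mem _ (Finset.mem_range.2 hi)))
  have hanswer : ∀ i < T, O ψ (M.queryWord (O ψ) x y z i) = O ψ' (M.queryWord (O ψ) x y z i) :=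
    fun i hi => answer_update_congr β (hproduct i hi)
  refine ⟨Finset.image_congr fun i hi => ?_,
    iff_of_eq (congrArg (· = some true) (output_congr hanswer).symm)⟩
  have hi : i < T := Finset.mem_range.1 hi
  simp only [entry, ← queryWord_congr hanswer hi.le, hproduct i hi]

lemma exists_forall_mem_cylinder_output_eq (M : OracleTM) (β : ∀ n, GroupGate n) (x : List Bool)
    (T q r : ℕ) : ∃ m, ∀ β' ∈ PiNat.cylinder β m, ∀ (y : Str q) (z : Str r),
      M.output (GroupOracle.ofGates β').answer T x y.toList z.toList =
        M.output (GroupOracle.ofGates β).answer T x y.toList z.toList := by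
  let queryLength (p : Str q × Str r × Fin T) : ℕ :=
    (M.queryWord (GroupOracle.ofGates β).answer x p.1.toList p.2.1.toList p.2.2).length
  refine ⟨Finset.univ.sup queryLength, fun β' hβ' y z =>
    (output_congr fun i hi => GroupOracle.answer_congr fun n hn => ?_).symm⟩
  have hle : 2 * n + 2 ≤ Finset.univ.sup queryLength :=
    hn ▸ Finset.le_sup (f := queryLength) (Finset.mem_univ (y, z, ⟨i, hi⟩))
  exact congrArg Subtype.val (hβ' n (by omega)).symm

/-- The machine `M` with oracle `O` proves in time `T` that `P` holds for `x`, in the sense of the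
class MA, with certificates of length `q` and random strings of length `r`. -/
def VerifiesAt (M : OracleTM) (O : List Bool → List Bool) (T q r : ℕ) (x : List Bool) (P : Prop) :
    Prop :=
  (P → ∃ y : Str q, ∀ z : Str r, M.output O T x y.toList z.toList = some true) ∧
    (¬ P → ∀ y : Str q,
      (2 ^ q) ^ 2 * #{z : Str r | M.output O T x y.toList z.toList = some true} < 2 ^ r)

lemma exists_forall_mem_cylinder_verifiesAt_iff (M : OracleTM) (β : ∀ n, GroupGate n)
    (T q r : ℕ) (x : List Bool) : ∃ m, ∀ β' ∈ PiNat.cylinder β m, ∀ P,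
      M.VerifiesAt (GroupOracle.ofGates β').answer T q r x P ↔
        M.VerifiesAt (GroupOracle.ofGates β).answer T q r x P := by
  obtain ⟨m, hm⟩ := M.exists_forall_mem_cylinder_output_eq β x T q r
  exact ⟨m, fun β' hβ' P => by simp only [VerifiesAt, hm β' hβ']⟩

end OracleTM

lemma exists_verifiesAt_of_mem_MA {B : GroupOracle} {A : Language Bool} (hA : A ∈ MA B) :
    ∃ (M : OracleTM) (t q r : ℕ[X]), q ≠ 0 ∧ ∀ x, M.VerifiesAt B.answer (t.eval x.length)
      (q.eval x.length) (r.eval x.length) x (x ∈ A) := by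
  obtain ⟨R, q, r, ⟨M, t, hM⟩, hq, hR⟩ := hA
  refine ⟨M, t.comp (X + q + r), q, r, hq, fun x => ?_⟩
  have houtput (y : Str (q.eval x.length)) (z : Str (r.eval x.length)) :
      M.output B.answer ((t.comp (X + q + r)).eval x.length) x y.toList z.toList = some true ↔
        R x y.toList z.toList = true := by
    have h := hM x y.toList z.toList
    rw [List.Vector.toList_length, List.Vector.toList_length] at h
    rw [eval_comp, eval_add, eval_add, eval_X, h, Option.some_inj]
  have hcount (y : Str (q.eval x.length)) : acceptCount R x y.toList (r.eval x.length) =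
      #{z : Str (r.eval x.length) | R x y.toList z.toList = true} := Fintype.card_subtype _
  simp only [OracleTM.VerifiesAt, houtput]
  refine ⟨fun hx => ?_, fun hx y => ?_⟩
  · obtain ⟨y, hy⟩ := (hR x).1 hx
    rw [hcount] at hy
    exact ⟨y, fun z => Finset.card_filter_eq_iff.1 (hy.trans (by simp [card_vector])) z
      (Finset.mem_univ z)⟩
  · have h := (hR x).2 hx y
    rw [← div_eq_inv_mul, lt_div_iff₀ (by positivity), hcount, mul_comm, mul_comm 2, pow_mul] at h
    exact_mod_cast h

section Diagonalization

/-- The Baire category theorem for a product of discrete spaces. -/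
lemma exists_forall_of_forall_exists_mem_cylinder {ι : Type*} [Countable ι] {E : ℕ → Type*}
    [Nonempty (∀ n, E n)] {p : ι → (∀ n, E n) → Prop}
    (h : ∀ i f m, ∃ g ∈ PiNat.cylinder f m, ∃ m', ∀ g' ∈ PiNat.cylinder g m', p i g') :
    ∃ f, ∀ i, p i f := by
  let _ (n : ℕ) : TopologicalSpace (E n) := ⊥
  have (n : ℕ) : DiscreteTopology (E n) := ⟨rfl⟩
  have hdense (i : ι) : Dense (interior {f | p i f}) := by
    refine (PiNat.isTopologicalBasis_cylinders E).dense_iff.2 ?_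
    rintro _ ⟨f, m, rfl⟩ -
    obtain ⟨g, hg, m', hm'⟩ := h i f m
    exact ⟨g, hg, mem_interior.2
      ⟨_, hm', PiNat.isOpen_cylinder E g m', PiNat.self_mem_cylinder g m'⟩⟩
  obtain ⟨f, hf⟩ := (dense_iInter_of_isOpen (fun _ => isOpen_interior) hdense).nonempty
  exact ⟨f, fun i => interior_subset (Set.mem_iInter.1 hf i)⟩

lemma exists_ge_two_mul_sq_le_two_pow (p : ℕ[X]) (m : ℕ) :
    ∃ k ≥ m, 2 * (k + 1 + 3 * p.eval k) ^ 2 ≤ 2 ^ k := by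
  obtain ⟨k, hk, hm⟩ := ((eventually_eval_le_two_pow (2 * (X + 1 + 3 * p) ^ 2)).and
    (Filter.eventually_ge_atTop m)).exists
  exact ⟨k, hm, by simpa using hk⟩

lemma card_filter_snd_eq {α β : Type*} [Fintype α] [Fintype β] [DecidableEq β] (b : β) :
    #{p : α × β | p.2 = b} = Fintype.card α := by
  have hfilter : ({p | p.2 = b} : Finset (α × β)) = Finset.univ ×ˢ {b} := by
    ext
    simp only [Finset.mem_filter_univ, Finset.mem_product, Finset.mem_univ, true_and,
      Finset.mem_singleton]
  rw [hfilter, Finset.card_product, Finset.card_singleton, mul_one, Finset.card_univ]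

lemma exists_labeling_span_eq_ker_snd (k : ℕ) :
    ∃ (ψ : Str (k + 1) ≃ (Fin k → ZMod 2) × ZMod 2) (gs : List (Str (k + 1))), gs.length = k ∧
      Submodule.span (ZMod 2) (ψ '' {x | x ∈ gs}) = LinearMap.ker (LinearMap.snd ..) := by
  obtain ⟨ψ⟩ : Nonempty (Str (k + 1) ≃ (Fin k → ZMod 2) × ZMod 2) :=
    Fintype.card_eq.1 (by simp [card_vector, pow_succ])
  refine ⟨ψ, .ofFn fun i => ψ.symm (LinearMap.inl (ZMod 2) _ _ (Pi.basisFun _ _ i)),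
    List.length_ofFn, ?_⟩
  have himage : ψ '' {x | x ∈ List.ofFn fun i => ψ.symm
      (LinearMap.inl (ZMod 2) _ _ (Pi.basisFun _ _ i))} =
      LinearMap.inl (ZMod 2) _ (ZMod 2) '' Set.range (Pi.basisFun (ZMod 2) (Fin k)) := by
    simp only [List.mem_ofFn, ← Set.range_comp']
    ext v
    simp
  rw [himage, ← Submodule.map_span, Module.Basis.span_eq, Submodule.map_top, LinearMap.range_inl]

lemma encodeInstance_mem_GNM_iff_of_gate_eq_vectorGate {n : ℕ} {V : Type} [AddCommGroup V]
    [Module (ZMod 2) V] {B : GroupOracle} {ψ ψ₀ : Str n ≃ V} {gs : List (Str n)}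
    {χ : V →ₗ[ZMod 2] ZMod 2} (hB : B.gate n = (vectorGate ψ).1) (hψ : ∀ g ∈ gs, ψ g = ψ₀ g)
    (hspan : Submodule.span (ZMod 2) (ψ₀ '' {x | x ∈ gs}) = LinearMap.ker χ) (h : Str n) :
    encodeInstance gs h ∈ GNM B ↔ χ (ψ h) ≠ 0 := by
  have himage : ψ '' {x | x ∈ gs} = ψ₀ '' {x | x ∈ gs} := Set.image_congr hψ
  rw [encodeInstance_mem_GNM, nonMember_iff_of_gate_eq_vectorGate hB, himage, hspan,
    LinearMap.mem_ker]

lemma exists_relabeling_not_verifiesAt {n T q r : ℕ} {V : Type} [AddCommGroup V]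
    [Module (ZMod 2) V] [Fintype V] (M : OracleTM) (β : ∀ n, GroupGate n)
    (x : List Bool) {ψ₀ : Str n ≃ V} {A : Finset (Str n)} {b : Str n} (χ : V →ₗ[ZMod 2] ZMod 2)
    (hA : ∀ a ∈ A, χ (ψ₀ a) = 0) (hb : χ (ψ₀ b) = 1)
    (hT : 2 * (#A + 1 + 3 * T) ^ 2 ≤ #{v | χ v = 0}) (hq : 0 < q) :
    ∃ ψ : Str n ≃ V, (∀ a ∈ A, ψ a = ψ₀ a) ∧
      ¬ M.VerifiesAt (GroupOracle.ofGates (Function.update β n (vectorGate ψ))).answer T q r x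
        (χ (ψ b) ≠ 0) := by
  classical
  have hY : 2 ≤ Fintype.card (Str q) := by
    simpa [card_vector] using Nat.le_self_pow hq.ne' 2
  obtain ⟨ψ, hψ, hrejected⟩ | ⟨ψ, hψ, y, haccepted⟩ := exists_relabeling_not_verified
    (fun (y : Str q) (z : Str r) => M.decidedByQueries_output β x y.toList z.toList T) χ hA hb hT hY
  · obtain ⟨hψA, hψb⟩ := mem_relabelings.1 hψ
    refine ⟨ψ, hψA, fun hverifies => ?_⟩
    obtain ⟨y, hy⟩ := hverifies.1 (by simp [Finset.mem_singleton.1 hψb, hb])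
    obtain ⟨z, hz⟩ := hrejected y
    exact hz (hy z)
  · obtain ⟨hψA, hψb⟩ := mem_relabelings.1 hψ
    refine ⟨ψ, hψA, fun hverifies => haccepted.not_gt ?_⟩
    simpa [card_vector] using hverifies.2 (by simpa using hψb) y

theorem exists_mem_cylinder_not_verifiesAt (M : OracleTM) (t : ℕ[X]) {q : ℕ[X]} (hq : q ≠ 0)
    (r : ℕ[X]) (β : ∀ n, GroupGate n) (m : ℕ) :
    ∃ γ ∈ PiNat.cylinder β m, ∃ m', ∀ γ' ∈ PiNat.cylinder γ m', ∃ x,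
      ¬ M.VerifiesAt (GroupOracle.ofGates γ').answer (t.eval x.length) (q.eval x.length)
        (r.eval x.length) x (x ∈ GNM (GroupOracle.ofGates γ')) := by
  let ℓ : ℕ[X] := X + 1 + (X + 1 + 1 + (X * (X + 1) + (X + 1)))
  obtain ⟨k, hkm, hk⟩ := exists_ge_two_mul_sq_le_two_pow (t.comp ℓ) m
  obtain ⟨ψ₀, gs, hgs, hspan⟩ := exists_labeling_span_eq_ker_snd k
  let χ := LinearMap.snd (ZMod 2) (Fin k → ZMod 2) (ZMod 2)
  let b : Str (k + 1) := ψ₀.symm (0, 1)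
  let x := encodeInstance gs b
  have hx : x.length = ℓ.eval k := by simp [x, ℓ, length_encodeInstance, hgs]
  have hA : ∀ a ∈ gs.toFinset, χ (ψ₀ a) = 0 := fun a ha =>
    LinearMap.mem_ker.1 (hspan ▸ Submodule.subset_span ⟨a, List.mem_toFinset.1 ha, rfl⟩)
  have hT : 2 * (#gs.toFinset + 1 + 3 * t.eval x.length) ^ 2 ≤ #{v | χ v = 0} := by
    calc 2 * (#gs.toFinset + 1 + 3 * t.eval x.length) ^ 2
        ≤ 2 * (k + 1 + 3 * (t.comp ℓ).eval k) ^ 2 := by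
          rw [hx, eval_comp]
          gcongr
          exact gs.toFinset_card_le.trans hgs.le
      _ ≤ 2 ^ k := hk
      _ = #{v | χ v = 0} := ((card_filter_snd_eq 0).trans (by simp)).symm
  obtain ⟨ψ, hψ, hverifies⟩ := exists_relabeling_not_verifiesAt (q := q.eval x.length)
    (r := r.eval x.length) M β x (b := b) χ hA (by simp [b, χ]) hT
    (eval_pos_of_ne_zero hq (by simp [hx, ℓ]))
  let γ := Function.update β (k + 1) (vectorGate ψ)
  obtain ⟨m', hm'⟩ := M.exists_forall_mem_cylinder_verifiesAt_iff γ (t.eval x.length)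
    (q.eval x.length) (r.eval x.length) x
  refine ⟨γ, PiNat.cylinder_anti β (by omega) (PiNat.update_mem_cylinder β (k + 1) _),
    max m' (k + 2), fun γ' hγ' => ⟨x, ?_⟩⟩
  have hgate : γ' (k + 1) = vectorGate ψ := by
    rw [hγ' (k + 1) (by omega)]
    exact Function.update_self ..
  have hmem : x ∈ GNM (GroupOracle.ofGates γ') ↔ χ (ψ b) ≠ 0 :=
    encodeInstance_mem_GNM_iff_of_gate_eq_vectorGate (congrArg Subtype.val hgate)
      (fun a ha => hψ a (List.mem_toFinset.2 ha)) hspan b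
  rw [hm' γ' (PiNat.cylinder_anti γ (le_max_left _ _) hγ'), hmem]
  exact hverifies

instance (n : ℕ) : Nonempty (GroupGate n) :=
  ⟨vectorGate (Fintype.card_eq.1 (by simp [card_vector])).some (V := Fin n → ZMod 2)⟩

instance : Countable ℕ[X] := Cardinal.mk_le_aleph0_iff.1 (cardinalMk_le_max.trans (by simp))

end Diagonalization

end BlackBox

theorem theorem3 : ∃ B : BlackBox.GroupOracle, BlackBox.GNM B ∉ BlackBox.MA B := by
  obtain ⟨β, hβ⟩ := BlackBox.exists_forall_of_forall_exists_mem_cylinder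
    (ι := BlackBox.OracleTM × ℕ[X] × {q : ℕ[X] // q ≠ 0} × ℕ[X])
    (p := fun ⟨M, t, q, r⟩ β => ∃ x, ¬ M.VerifiesAt (BlackBox.GroupOracle.ofGates β).answer
      (t.eval x.length) (q.1.eval x.length) (r.eval x.length) x
      (x ∈ BlackBox.GNM (BlackBox.GroupOracle.ofGates β)))
    fun ⟨M, t, q, r⟩ => BlackBox.exists_mem_cylinder_not_verifiesAt M t q.2 r
  refine ⟨.ofGates β, fun hmem => ?_⟩
  obtain ⟨M, t, q, r, hq, hverifies⟩ := BlackBox.exists_verifiesAt_of_mem_MA hmem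
  obtain ⟨x, hx⟩ := hβ (M, t, ⟨q, hq⟩, r)
  exact hx (hverifies x)
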